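/- Let $k$ be a field, $R=k[x_1,\dots,x_n]$, and let $I\subseteq R$ be a square-free monomial ideal with minimal monomial generators $(m_v)_{v\in V}$, $V$ a finite set. Its (dual) hypergraph is $\mathcal H=\mathcal H(I)=\{\{v\in V : x_i\mid m_v\} : 1\le i\le n\}$, a set of subsets (faces) of $V=V(\mathcal H)$; assume that the faces cover $V$ (it is then separated: for all $u\ne v$ there are a face containing $u$ but not $v$ and a face containing $v$ but not $u$). Put $\mathrm{pd}(\mathcal H)=\mathrm{pd}_R(R/I)$. A vertex $v$ is closed if $\{v\}\in\mathcal H$; two distinct vertices are adjacent if some face contains both. Suppose that $\mathcal H$ is 1-dimensional (every face has at most two elements). A star with center $w$ is a connected (part of a) hypergraph which contains no cycle and no two adjacent closed vertices, and in which no vertex other than $w$ has three or more neighbors; that is, it consists of the vertex $w$ with strings attached to it. Its branches are the connected components left after removing $w$, and the length of a branch is its number of vertices. A proper $2$-star is a star all of whose branches have length at most $2$ and at least one of whose branches has length exactly $2$. A tree (resp. cycle) of proper $2$-stars is a connected hypergraph whose vertex set is partitioned into the vertex sets of proper $2$-stars such that vertices in distinct stars are adjacent only if both are centers, and the centers form a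 tree, possibly with a single vertex (resp. a cycle, of length at least $3$). If every connected component of $\mathcal H$ is a tree or a cycle of proper $2$-stars, then $$\mathrm{pd}(\mathcal H)=|V(\mathcal H)|-T(\mathcal H),$$ where $T(\mathcal H)$ is the number of these proper $2$-stars. -/

import Mathlib

open CategoryTheory

/-- A (dual) hypergraph on the vertex set `V`: a set of subsets (faces) of `V` which cover `V`. -/
structure DualHypergraph (V : Type*) where
  faces : Set (Finset V)
  covers : ∀ v : V, ∃ F ∈ faces, v ∈ F

namespace DualHypergraph

variable {V : Type*} (H : DualHypergraph V)

/-- Any two distinct vertices are separated, in both directions, by faces. -/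
def IsSeparated : Prop :=
  ∀ u v : V, u ≠ v → ∃ F₁ ∈ H.faces, ∃ F₂ ∈ H.faces, (u ∈ F₁ ∧ u ∉ F₂) ∧ (v ∈ F₂ ∧ v ∉ F₁)

/-- The vertex `v` is closed if `{v}` is a face; otherwise it is open. -/
def IsClosedVertex (v : V) : Prop := ({v} : Finset V) ∈ H.faces

/-- Every face has dimension at most one, that is, at most two vertices. -/
def IsOneDimensional : Prop := ∀ F ∈ H.faces, F.card ≤ 2

/-- The neighbour graph: two distinct vertices are neighbours if some face contains both. -/
def graph : SimpleGraph V where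
  Adj u v := u ≠ v ∧ ∃ F ∈ H.faces, u ∈ F ∧ v ∈ F
  symm := ⟨fun _ _ ⟨h, F, hF, hu, hv⟩ => ⟨h.symm, F, hF, hv, hu⟩⟩
  loopless := ⟨fun _ h => h.1 rfl⟩

/-- The restriction of the one-dimensional hypergraph `H` to the vertex set `U` is a star with
center `w`: it is connected and has no cycle, no two adjacent vertices of it are both closed, and
no vertex other than `w` is a joint (a vertex with at least three neighbours in the star). So the
star is the vertex `w` together with finitely many strings attached to it. -/
structure IsStar (U : Set V) (w : V) : Prop where
  center_mem : w ∈ U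
  connected : (H.graph.induce U).Connected
  acyclic : (H.graph.induce U).IsAcyclic
  not_adj_closed : ∀ u ∈ U, ∀ v ∈ U, H.graph.Adj u v →
    ¬ (H.IsClosedVertex u ∧ H.IsClosedVertex v)
  not_joint : ∀ v : U, (v : V) ≠ w → ¬ 3 ≤ ((H.graph.induce U).neighborSet v).ncard

/-- The branches of a star with vertex set `U` and center `w` are the connected components
that are left when `w` is removed. -/
abbrev Branch (U : Set V) (w : V) : Type _ := (H.graph.induce (U \ {w})).ConnectedComponent

/-- The length of a branch is its number of vertices. -/
noncomputable def branchLength {U : Set V} {w : V} (B : H.Branch U w) : ℕ := B.supp.ncard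

/-- A `d`-star is a star all of whose branches have length at most `d`; it is a proper `d`-star
if, moreover, at least one branch has length exactly `d`. -/
structure IsProperStar (d : ℕ) (U : Set V) (w : V) : Prop extends H.IsStar U w where
  branch_le : ∀ B : H.Branch U w, H.branchLength B ≤ d
  exists_branch : ∃ B : H.Branch U w, H.branchLength B = d

/-- `H` is a disjoint union of trees and cycles of proper `d`-stars. The vertex set is partitioned
into stars, and `c` sends each vertex to the center of the star which contains it. Distinct stars
are connected only via their centers, and within each connected component of `H` the centers form
a tree or a cycle (a tree may have a single vertex, and strings are trees). -/
structure IsUnionOfTreesAndCyclesOfProperStars (d : ℕ) (c : V → V) : Prop where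
  one_dimensional : H.IsOneDimensional
  proper_star : ∀ w ∈ Set.range c, H.IsProperStar d {v | c v = w} w
  connected_via_centers : ∀ u v, H.graph.Adj u v → c u ≠ c v → c u = u ∧ c v = v
  tree_or_cycle : ∀ K : H.graph.ConnectedComponent,
    (H.graph.induce {w | w ∈ K.supp ∧ w ∈ Set.range c}).IsTree ∨
    ∃ n : ℕ, 3 ≤ n ∧
      Nonempty (H.graph.induce {w | w ∈ K.supp ∧ w ∈ Set.range c} ≃g SimpleGraph.cycleGraph n)

end DualHypergraph

/-- The square-free monomials `∏ i ∈ m v, X i`, for `v : V`, form the minimal monomial generating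
set of the ideal `I`: they generate `I` and none of them divides another one (for square-free
monomials, divisibility is inclusion of supports). -/
structure IsMinimalSquarefreeGenerators {k σ V : Type*} [Field k]
    (I : Ideal (MvPolynomial σ k)) (m : V → Finset σ) : Prop where
  span_eq : Ideal.span (Set.range fun v => ∏ i ∈ m v, (MvPolynomial.X i : MvPolynomial σ k)) = I
  minimal : ∀ u v, m u ⊆ m v → u = v

/-- The faces of the dual hypergraph of the ideal minimally generated by the square-free monomials
with supports `m v`: each variable `i` gives the face of all `v` whose monomial it divides. -/
def dualFaces {σ V : Type*} (m : V → Finset σ) : Set (Finset V) :=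
  {F | ∃ i : σ, ∀ v, v ∈ F ↔ i ∈ m v}

/-!
Let `W` be the set of centers and `A` the set of the other vertices, so that the claim is
`pd (R ⧸ I) = |A|`. It rests on the short exact sequence
`0 → R ⧸ (J : x) → R ⧸ J → R ⧸ (J + (x)) → 0`, used with `J` generated by some of the square-free
monomials and `x` another one. The colon ideal is again generated by square-free monomials: the
variables of `x` are deleted from the generators (`mul_sqfreeMonomial_mem_iff`).

The proof starts from the ideal `J` generated by `A` and adds the centers one by one.

* Each vertex of `A` lies on a face containing no other vertex of `A` (`exists_private_face`), so
  that each generator of `J` has a private variable. Then `pd (R ⧸ J) = |A|`. The upper bound holds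
  for any `|A|` monomials. For the lower bound, `Ext` into a residue ring of a point at which the
  private variables vanish and the other variables are `1` does not see the other variables
  (`subsingleton_ext_colon`), and for the ideal of the private variables it is nonzero in
  degree `|A|`, as in the Koszul complex.
* The star with center `w` has a branch of length two; let `a` be its vertex next to `w`, and `b`
  the other one. Separation forces `b` to be closed, hence `a` to be open, so every variable of `a`
  is a variable of `w` or of `b` (`exists_branch_pair`). In the colon by the monomial of `w`, the
  generator `b` is therefore redundant. Other stars meet `w` only in their centers, so their
  pairs `a`, `b` are untouched. By induction on the number of centers, the colon has
  projective dimension at most `|A| - 1` (`IsPaired.hasProjectiveDimensionLT`).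
* The exact sequence now shows that adding `w` does not change the projective dimension: it cannot
  exceed `|A|`, and it cannot drop, since the middle term has projective dimension `|A|` and the
  left term a smaller one (`IsPaired.not_hasProjectiveDimensionLT`).
-/

/-! ### Colon ideals and projective dimension -/

section Colon

open Abelian

universe u

variable {R : Type u} [CommRing R]

/-- The sequence `R ⧸ (J : x) → R ⧸ J → R ⧸ (J + (x))`, whose first map is multiplication by `x`.
The colon ideal enters as an arbitrary ideal `K` together with its defining property, so that any
convenient description of it can be plugged in. -/
noncomputable abbrev colonComplex (J K : Ideal R) (x : R) (hK : ∀ f, f * x ∈ J ↔ f ∈ K) :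
    ShortComplex (ModuleCat.{u} R) where
  X₁ := ModuleCat.of R (R ⧸ K)
  X₂ := ModuleCat.of R (R ⧸ J)
  X₃ := ModuleCat.of R (R ⧸ (J ⊔ Ideal.span {x}))
  f := ModuleCat.ofHom <| Submodule.mapQ K J (LinearMap.mulRight R x) fun f hf => (hK f).2 hf
  g := ModuleCat.ofHom <| Submodule.factor (le_sup_left : J ≤ J ⊔ Ideal.span {x})
  zero := by
    refine ModuleCat.hom_ext (LinearMap.ext fun f => ?_)
    obtain ⟨f, rfl⟩ := Submodule.mkQ_surjective _ f
    exact (Submodule.Quotient.mk_eq_zero _).2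
      (Ideal.mem_sup_right (Ideal.mul_mem_left _ f (Ideal.mem_span_singleton_self x)))

theorem colonComplex_shortExact (J K : Ideal R) (x : R) (hK : ∀ f, f * x ∈ J ↔ f ∈ K) :
    (colonComplex J K x hK).ShortExact := by
  refine ModuleCat.shortComplex_shortExact _ ?_ ?_ ?_
  · intro f
    obtain ⟨f, rfl⟩ := Submodule.mkQ_surjective _ f
    constructor
    · intro hf
      have hf' : f ∈ J ⊔ Ideal.span {x} := (Submodule.Quotient.mk_eq_zero _).1 hf
      obtain ⟨j, hj, y, hy, rfl⟩ := Submodule.mem_sup.1 hf'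
      obtain ⟨g, rfl⟩ := Ideal.mem_span_singleton'.1 hy
      refine ⟨Submodule.mkQ K g, ?_⟩
      refine (Submodule.Quotient.eq J).2 ?_
      simpa using hj
    · rintro ⟨g, hg⟩
      rw [← hg]
      exact ConcreteCategory.congr_hom (colonComplex J K x hK).zero g
  · refine (injective_iff_map_eq_zero _).2 fun f hf => ?_
    obtain ⟨f, rfl⟩ := Submodule.mkQ_surjective _ f
    exact (Submodule.Quotient.mk_eq_zero _).2
      ((hK f).1 ((Submodule.Quotient.mk_eq_zero _).1 hf))
  · exact Submodule.factor_surjective (le_sup_left : J ≤ J ⊔ Ideal.span {x})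

namespace CategoryTheory.Abelian.Ext

theorem smul_eq_zero_of_smul_tgt {M N : ModuleCat.{u} R} {r : R} (h : ∀ y : N, r • y = 0)
    {n : ℕ} (x : Ext M N n) : r • x = 0 := by
  have : r • 𝟙 N = 0 := by ext y; exact h y
  rw [smul_eq_comp_mk₀, this, mk₀_zero, comp_zero]

theorem smul_eq_zero_of_smul_src {M N : ModuleCat.{u} R} {r : R} (h : ∀ y : M, r • y = 0)
    {n : ℕ} (x : Ext M N n) : r • x = 0 := by
  have : r • 𝟙 M = 0 := by ext y; exact h y
  rw [← mk₀_id_comp (r • x), comp_smul, ← smul_comp, ← mk₀_smul, this, mk₀_zero, zero_comp]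

end CategoryTheory.Abelian.Ext

/-- `Ext` out of `R ⧸ J` vanishes only if `Ext` out of `R ⧸ (J : x)` does, as long as `x` acts
on the target as the identity: the next term `Ext (R ⧸ (J + (x)))` is both killed and fixed
by `x`. -/
theorem subsingleton_ext_colon {J K : Ideal R} {x : R} (hK : ∀ f, f * x ∈ J ↔ f ∈ K)
    {N : ModuleCat.{u} R} (hx : ∀ y : N, x • y = y) {n : ℕ}
    (h : Subsingleton (Ext (ModuleCat.of R (R ⧸ J)) N n)) :
    Subsingleton (Ext (ModuleCat.of R (R ⧸ K)) N n) := by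
  have hS := colonComplex_shortExact J K x hK
  refine subsingleton_of_forall_eq 0 fun e => ?_
  have h₃ : ∀ z : Ext (colonComplex J K x hK).X₃ N (1 + n), z = 0 := fun z => by
    have h₀ : x • z = 0 := Ext.smul_eq_zero_of_smul_src (fun y => by
      obtain ⟨y, rfl⟩ := Submodule.mkQ_surjective _ y
      exact (Submodule.Quotient.mk_eq_zero _).2
        (Ideal.mem_sup_right (Ideal.mul_mem_right _ _ (Ideal.mem_span_singleton_self x)))) z
    have h₁ : (x - 1) • z = 0 := Ext.smul_eq_zero_of_smul_tgt (fun y => by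
      rw [sub_smul, one_smul, hx, sub_self]) z
    rwa [sub_smul, one_smul, h₀, zero_sub, neg_eq_zero] at h₁
  obtain ⟨e₂, rfl⟩ := Ext.contravariant_sequence_exact₁ hS N e rfl (h₃ _)
  rw [show e₂ = 0 from h.elim _ _, Ext.comp_zero]

/-- Adding to `J` an element `x` which is regular modulo `J` and kills the target shifts the
nonvanishing of `Ext` by one: multiplication by `x`, which connects two consecutive terms of the
long exact sequence, is zero. -/
theorem subsingleton_ext_of_subsingleton_ext_succ {J : Ideal R} {x : R}
    (hJ : ∀ f, f * x ∈ J ↔ f ∈ J) {N : ModuleCat.{u} R} (hx : ∀ y : N, x • y = 0) {n : ℕ}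
    (h : Subsingleton (Ext (ModuleCat.of R (R ⧸ (J ⊔ Ideal.span {x}))) N (n + 1))) :
    Subsingleton (Ext (ModuleCat.of R (R ⧸ J)) N n) := by
  have hS := colonComplex_shortExact J J x hJ
  refine subsingleton_of_forall_eq 0 fun e => ?_
  obtain ⟨e₂, rfl⟩ := Ext.contravariant_sequence_exact₁ hS N e (add_comm 1 n) (h.elim _ _)
  have hf : (colonComplex J J x hJ).f = x • 𝟙 (ModuleCat.of R (R ⧸ J)) := by
    refine ModuleCat.hom_ext (LinearMap.ext fun f => ?_)
    obtain ⟨f, rfl⟩ := Submodule.mkQ_surjective _ f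
    change Submodule.Quotient.mk (f * x) = Submodule.Quotient.mk (x • f)
    rw [smul_eq_mul, mul_comm]
  have key : (Ext.mk₀ (x • 𝟙 (ModuleCat.of R (R ⧸ J)))).comp e₂ (zero_add n) = 0 := by
    rw [Ext.mk₀_smul, Ext.smul_comp, Ext.mk₀_id_comp]
    exact Ext.smul_eq_zero_of_smul_tgt hx _
  rw [← key]
  exact congrArg (fun φ => (Ext.mk₀ φ).comp e₂ (zero_add n)) hf

end Colon

/-! ### Ideals generated by square-free monomials -/

section Squarefree

open MvPolynomial

variable {k σ V : Type*} [Field k]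

/-- The square-free monomial with support `t`. -/
noncomputable def sqfreeMonomial (k : Type*) {σ : Type*} [Field k] (t : Finset σ) :
    MvPolynomial σ k := ∏ i ∈ t, X i

/-- The ideal generated by the square-free monomials with supports `m v`, for `v ∈ S`. -/
noncomputable def sqfreeIdeal (k : Type*) {σ V : Type*} [Field k] (m : V → Finset σ)
    (S : Finset V) : Ideal (MvPolynomial σ k) :=
  Ideal.span ((fun v => sqfreeMonomial k (m v)) '' S)

theorem sqfreeMonomial_eq_monomial (t : Finset σ) :
    sqfreeMonomial k t = monomial (Finsupp.indicator t fun _ _ => 1) 1 := by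
  classical
  rw [sqfreeMonomial, Finsupp.indicator_eq_sum_single, monomial_sum_one]
  rfl

theorem indicator_one_le_iff {t : Finset σ} {d : σ →₀ ℕ} :
    (Finsupp.indicator t fun _ _ => 1) ≤ d ↔ t ⊆ d.support := by
  classical
  constructor
  · intro h i hi
    have := h i
    rw [Finsupp.indicator_of_mem hi] at this
    exact Finsupp.mem_support_iff.2 (by lia)
  · intro h i
    by_cases hi : i ∈ t
    · rw [Finsupp.indicator_of_mem hi]
      have := Finsupp.mem_support_iff.1 (h hi)
      lia
    · rw [Finsupp.indicator_of_notMem hi]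
      exact Nat.zero_le _

theorem mem_sqfreeIdeal {m : V → Finset σ} {S : Finset V} {f : MvPolynomial σ k} :
    f ∈ sqfreeIdeal k m S ↔ ∀ d ∈ f.support, ∃ v ∈ S, m v ⊆ d.support := by
  have : (fun v => sqfreeMonomial k (m v)) '' (S : Set V) =
      (fun s => monomial s (1 : k)) '' ((fun v => Finsupp.indicator (m v) fun _ _ => 1) '' S) := by
    rw [Set.image_image]
    exact Set.image_congr fun v _ => sqfreeMonomial_eq_monomial _
  rw [sqfreeIdeal, this, mem_ideal_span_monomial_image]
  simp [indicator_one_le_iff]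

/-- The colon of a square-free monomial ideal by a square-free monomial. -/
theorem mul_sqfreeMonomial_mem_iff [DecidableEq σ] (m : V → Finset σ) (S : Finset V) (t : Finset σ)
    (f : MvPolynomial σ k) :
    f * sqfreeMonomial k t ∈ sqfreeIdeal k m S ↔ f ∈ sqfreeIdeal k (fun v => m v \ t) S := by
  have hs (d : σ →₀ ℕ) : (d + Finsupp.indicator t fun _ _ => 1).support = d.support ∪ t := by
    ext i
    by_cases hi : i ∈ t
    · simp [hi, Finsupp.indicator_of_mem hi]
    · simp [hi, Finsupp.indicator_of_notMem hi]
  have hm : (f * sqfreeMonomial k t).support =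
      f.support.map (addRightEmbedding (Finsupp.indicator t fun _ _ => 1)) := by
    rw [sqfreeMonomial_eq_monomial]
    exact AddMonoidAlgebra.support_coeff_mul_single _ _ (by simp) _
  simp only [mem_sqfreeIdeal, hm, Finset.mem_map, addRightEmbedding_apply, forall_exists_index,
    and_imp, forall_apply_eq_imp_iff₂, hs]
  simp only [sdiff_le_iff, Finset.union_comm, Finset.sup_eq_union]

theorem sqfreeIdeal_insert [DecidableEq V] (m : V → Finset σ) (S : Finset V) (v : V) :
    sqfreeIdeal k m (insert v S) = sqfreeIdeal k m S ⊔ Ideal.span {sqfreeMonomial k (m v)} := by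
  rw [sqfreeIdeal, Finset.coe_insert, Set.image_insert_eq, Ideal.span_insert, sup_comm]
  rfl

theorem sqfreeIdeal_erase [DecidableEq V] {m : V → Finset σ} {S : Finset V} {a b : V}
    (ha : a ∈ S) (hab : a ≠ b) (h : m a ⊆ m b) : sqfreeIdeal k m (S.erase b) = sqfreeIdeal k m S := by
  ext f
  simp only [mem_sqfreeIdeal]
  refine forall₂_congr fun d _ => ⟨fun ⟨v, hv, hd⟩ => ⟨v, Finset.mem_of_mem_erase hv, hd⟩, ?_⟩
  rintro ⟨v, hv, hd⟩
  by_cases hvb : v = b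
  · exact ⟨a, Finset.mem_erase.2 ⟨hab, ha⟩, h.trans (hvb ▸ hd)⟩
  · exact ⟨v, Finset.mem_erase.2 ⟨hvb, hv⟩, hd⟩

end Squarefree

section Bounds

open MvPolynomial

variable {k σ V : Type*} [Field k]

theorem sqfreeIdeal_empty (m : V → Finset σ) : sqfreeIdeal k m ∅ = ⊥ := by
  simp [sqfreeIdeal]

theorem sqfreeIdeal_congr {m m' : V → Finset σ} {S : Finset V} (h : ∀ v ∈ S, m v = m' v) :
    sqfreeIdeal k m S = sqfreeIdeal k m' S := by
  rw [sqfreeIdeal, sqfreeIdeal, Set.image_congr fun v hv => by rw [h v hv]]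

/-! ### A lower bound from private variables -/

/-- For the ideal of some variables, `Ext` into a residue ring of a point at which these
variables vanish is nonzero in degree the number of variables. -/
theorem not_subsingleton_ext_variables (ε : σ → k) (p : V → σ) (S : Finset V)
    (hp : Set.InjOn p S) (hε : ∀ v ∈ S, ε (p v) = 0) :
    ¬ Subsingleton (Abelian.Ext
      (ModuleCat.of (MvPolynomial σ k) (MvPolynomial σ k ⧸ sqfreeIdeal k (fun v => {p v}) S))
      (ModuleCat.of (MvPolynomial σ k) (MvPolynomial σ k ⧸ RingHom.ker (eval ε))) S.card) := by
  classical
  induction S using Finset.induction_on with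
  | empty =>
    intro h
    rw [Finset.card_empty] at h
    have h' := Abelian.Ext.homEquiv₀.symm.subsingleton_congr.mpr h
    have h₀ := h'.elim (ModuleCat.ofHom (Submodule.factor
      ((sqfreeIdeal_empty (k := k) fun v => {p v}).trans_le
        (bot_le (a := RingHom.ker (eval ε)))))) 0
    have h₁ := ConcreteCategory.congr_hom h₀ (Submodule.Quotient.mk 1)
    have h₂ : (1 : MvPolynomial σ k) ∈ RingHom.ker (eval ε) :=
      (Submodule.Quotient.mk_eq_zero _).1 h₁
    simp at h₂
  | insert v S hv ih =>
    intro h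
    rw [Finset.card_insert_of_notMem hv, sqfreeIdeal_insert] at h
    refine ih (hp.mono (by simp)) (fun u hu => hε u (Finset.mem_insert_of_mem hu))
      (subsingleton_ext_of_subsingleton_ext_succ (fun f => ?_) (fun y => ?_) h)
    · rw [mul_sqfreeMonomial_mem_iff, sqfreeIdeal_congr fun u hu => ?_]
      refine Finset.sdiff_eq_self_of_disjoint (Finset.disjoint_singleton.2 fun huv => hv ?_)
      rwa [← hp (by simp [hu]) (by simp) huv]
    · obtain ⟨y, rfl⟩ := Submodule.mkQ_surjective _ y
      refine (Submodule.Quotient.mk_eq_zero _).2 (Ideal.mul_mem_right _ _ ?_)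
      simpa [sqfreeMonomial, RingHom.mem_ker] using hε v (Finset.mem_insert_self v S)

/-- If each generator is divisible by a variable which divides no other generator, then the
projective dimension is at least the number of generators. The colon by the product of all the
other variables is the ideal of the private variables. -/
theorem not_hasProjectiveDimensionLT_of_private {m : V → Finset σ} {S : Finset V} (p : V → σ)
    (hp : ∀ v ∈ S, p v ∈ m v) (hp' : ∀ u ∈ S, ∀ v ∈ S, u ≠ v → p u ∉ m v) :
    ¬ HasProjectiveDimensionLT
      (ModuleCat.of (MvPolynomial σ k) (MvPolynomial σ k ⧸ sqfreeIdeal k m S)) S.card := by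
  classical
  intro h
  set t : Finset σ := S.biUnion m \ S.image p with ht
  -- The point whose private coordinates are `0` and whose other coordinates are `1`.
  let ε : σ → k := fun i => if i ∈ S.image p then 0 else 1
  have hm : ∀ v ∈ S, m v \ t = {p v} := fun v hv => by
    ext i
    simp only [ht, Finset.mem_sdiff, Finset.mem_biUnion, Finset.mem_image, Finset.mem_singleton,
      not_and, not_not]
    constructor
    · rintro ⟨hi, h⟩
      obtain ⟨u, hu, rfl⟩ := h ⟨v, hv, hi⟩
      by_cases huv : u = v
      · rw [huv]
      · exact absurd hi (hp' u hu v hv huv)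
    · rintro rfl
      exact ⟨hp v hv, fun _ => ⟨v, hv, rfl⟩⟩
  have hinj : Set.InjOn p S := fun u hu v hv huv => by
    by_contra hne
    exact hp' u hu v hv hne (huv ▸ hp v hv)
  refine not_subsingleton_ext_variables ε p S hinj
    (fun v hv => if_pos (Finset.mem_image_of_mem p hv)) ?_
  refine subsingleton_ext_colon (J := sqfreeIdeal k m S) (x := sqfreeMonomial k t) (fun f => ?_)
    (fun y => ?_) (HasProjectiveDimensionLT.subsingleton _ S.card _ le_rfl _)
  · rw [mul_sqfreeMonomial_mem_iff, sqfreeIdeal_congr hm]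
  · obtain ⟨y, rfl⟩ := Submodule.mkQ_surjective _ y
    refine (Submodule.Quotient.eq _).2 ?_
    have hε : eval ε (sqfreeMonomial k t) = 1 := by
      rw [sqfreeMonomial, map_prod]
      refine Finset.prod_eq_one fun i hi => ?_
      rw [eval_X]
      exact if_neg (Finset.mem_sdiff.1 hi).2
    change eval ε (sqfreeMonomial k t * y - y) = 0
    rw [map_sub, map_mul, hε, one_mul, sub_self]

/-! ### Adding generators one at a time -/

theorem sqfreeIdeal_colon_shortExact [DecidableEq σ] (m : V → Finset σ) (S : Finset V) (w : V) :
    (colonComplex (sqfreeIdeal k m S) (sqfreeIdeal k (fun v => m v \ m w) S)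
      (sqfreeMonomial k (m w)) (mul_sqfreeMonomial_mem_iff m S (m w))).ShortExact :=
  colonComplex_shortExact ..

/-- The projective dimension is at most the number of generators. -/
theorem hasProjectiveDimensionLT_card_add_one (m : V → Finset σ) (S : Finset V) :
    HasProjectiveDimensionLT
      (ModuleCat.of (MvPolynomial σ k) (MvPolynomial σ k ⧸ sqfreeIdeal k m S)) (S.card + 1) := by
  classical
  induction S using Finset.induction_on generalizing m with
  | empty =>
    rw [Finset.card_empty, zero_add, sqfreeIdeal_empty,
      ← projective_iff_hasProjectiveDimensionLT_one, ← IsProjective.iff_projective]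
    exact Module.Projective.of_equiv (Submodule.quotEquivOfEqBot ⊥ rfl).symm
  | insert w S hw ih =>
    rw [Finset.card_insert_of_notMem hw, sqfreeIdeal_insert]
    have := ih m
    exact (sqfreeIdeal_colon_shortExact m S w).hasProjectiveDimensionLT_X₃ _ (ih _)
      (hasProjectiveDimensionLT_of_ge _ (S.card + 1) _ (Nat.le_succ _))

/-- Each `w ∈ W` comes with two generators `a w` and `b w` from `A` such that `b w` becomes
redundant once the variables of the generator `w` are inverted, and these pairs do not interfere
with each other. -/
structure IsPaired (m : V → Finset σ) (A W : Finset V) (a b : V → V) : Prop where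
  disjoint : Disjoint A W
  left_mem : ∀ w ∈ W, a w ∈ A
  right_mem : ∀ w ∈ W, b w ∈ A
  ne : ∀ w ∈ W, a w ≠ b w
  mem_or_mem : ∀ w ∈ W, ∀ i ∈ m (a w), i ∈ m w ∨ i ∈ m (b w)
  left_ne : ∀ w ∈ W, ∀ w' ∈ W, w ≠ w' → a w' ≠ b w
  right_ne : ∀ w ∈ W, ∀ w' ∈ W, w ≠ w' → b w' ≠ b w
  left_disjoint : ∀ w ∈ W, ∀ w' ∈ W, w ≠ w' → Disjoint (m (a w')) (m w)
  right_disjoint : ∀ w ∈ W, ∀ w' ∈ W, w ≠ w' → Disjoint (m (b w')) (m w)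

namespace IsPaired

variable {m : V → Finset σ} {A W : Finset V} {a b : V → V}

theorem mono {W' : Finset V} (h : IsPaired m A W a b) (hW : W' ⊆ W) : IsPaired m A W' a b where
  disjoint := h.disjoint.mono_right hW
  left_mem w hw := h.left_mem w (hW hw)
  right_mem w hw := h.right_mem w (hW hw)
  ne w hw := h.ne w (hW hw)
  mem_or_mem w hw := h.mem_or_mem w (hW hw)
  left_ne w hw w' hw' := h.left_ne w (hW hw) w' (hW hw')
  right_ne w hw w' hw' := h.right_ne w (hW hw) w' (hW hw')
  left_disjoint w hw w' hw' := h.left_disjoint w (hW hw) w' (hW hw')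
  right_disjoint w hw w' hw' := h.right_disjoint w (hW hw) w' (hW hw')

variable [DecidableEq σ] [DecidableEq V]

/-- Taking the colon by the generator `w` frees `b w` and preserves the other pairs. -/
theorem colon {w : V} (h : IsPaired m A (insert w W) a b) (hw : w ∉ W) :
    IsPaired (fun v => m v \ m w) (A.erase (b w)) W a b := by
  have hi := Finset.mem_insert_self w W
  have hs {w' : V} (hw' : w' ∈ W) : w' ∈ insert w W := Finset.mem_insert_of_mem hw'
  have hne {w' : V} (hw' : w' ∈ W) : w ≠ w' := fun e => hw (e ▸ hw')
  refine ⟨?_, fun w' hw' => ?_, fun w' hw' => ?_, fun w' hw' => h.ne w' (hs hw'),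
    fun w' hw' i hi' => ?_, fun u hu v hv => h.left_ne u (hs hu) v (hs hv),
    fun u hu v hv => h.right_ne u (hs hu) v (hs hv),
    fun u hu v hv huv => ?_, fun u hu v hv huv => ?_⟩
  · exact h.disjoint.mono (Finset.erase_subset _ _) (Finset.subset_insert _ _)
  · exact Finset.mem_erase.2 ⟨h.left_ne w hi w' (hs hw') (hne hw'), h.left_mem w' (hs hw')⟩
  · exact Finset.mem_erase.2 ⟨h.right_ne w hi w' (hs hw') (hne hw'), h.right_mem w' (hs hw')⟩
  · obtain ⟨hi', hi''⟩ := Finset.mem_sdiff.1 hi'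
    exact (h.mem_or_mem w' (hs hw') i hi').imp (fun h => Finset.mem_sdiff.2 ⟨h, hi''⟩)
      fun h => Finset.mem_sdiff.2 ⟨h, hi''⟩
  · exact (h.left_disjoint u (hs hu) v (hs hv) huv).mono Finset.sdiff_subset Finset.sdiff_subset
  · exact (h.right_disjoint u (hs hu) v (hs hv) huv).mono Finset.sdiff_subset Finset.sdiff_subset

theorem sqfreeIdeal_colon {w : V} (h : IsPaired m A (insert w W) a b) :
    sqfreeIdeal k (fun v => m v \ m w) (A.erase (b w) ∪ W) =
      sqfreeIdeal k (fun v => m v \ m w) (A ∪ W) := by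
  have hi := Finset.mem_insert_self w W
  have hb : b w ∉ W := fun hb =>
    Finset.disjoint_left.1 h.disjoint (h.right_mem w hi) (Finset.mem_insert_of_mem hb)
  rw [← sqfreeIdeal_erase (Finset.mem_union_left W (h.left_mem w hi)) (h.ne w hi),
    Finset.erase_union_distrib, Finset.erase_eq_of_notMem hb]
  intro i hia
  obtain ⟨hia, hiw⟩ := Finset.mem_sdiff.1 hia
  exact Finset.mem_sdiff.2 ⟨(h.mem_or_mem w hi i hia).resolve_left hiw, hiw⟩

omit [DecidableEq σ]

/-- The generators in `W` do not raise the bound `|A|`: by induction on `W`, the colon by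
`w ∈ W`, where `b w` is redundant, has projective dimension at most `|A| - 1`. -/
theorem hasProjectiveDimensionLT (h : IsPaired m A W a b) :
    HasProjectiveDimensionLT
      (ModuleCat.of (MvPolynomial σ k) (MvPolynomial σ k ⧸ sqfreeIdeal k m (A ∪ W)))
      (A.card + 1) := by
  classical
  induction W using Finset.induction_on generalizing m A with
  | empty =>
    rw [Finset.union_empty]
    exact hasProjectiveDimensionLT_card_add_one m A
  | insert w W hw ih =>
    have hc := ih (h.colon hw)
    rw [h.sqfreeIdeal_colon,
      Finset.card_erase_add_one (h.right_mem w (Finset.mem_insert_self w W))] at hc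
    rw [Finset.union_insert, sqfreeIdeal_insert]
    exact (sqfreeIdeal_colon_shortExact m (A ∪ W) w).hasProjectiveDimensionLT_X₃ _ hc
      (ih (h.mono (Finset.subset_insert w W)))

/-- The generators in `W` do not lower the projective dimension `|A|`: the colon by `w ∈ W`
has a smaller one, so the quotient by `w` inherits that of the middle term of the exact sequence. -/
theorem not_hasProjectiveDimensionLT (h : IsPaired m A W a b) (p : V → σ)
    (hp : ∀ v ∈ A, p v ∈ m v) (hp' : ∀ u ∈ A, ∀ v ∈ A, u ≠ v → p u ∉ m v) :
    ¬ HasProjectiveDimensionLT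
      (ModuleCat.of (MvPolynomial σ k) (MvPolynomial σ k ⧸ sqfreeIdeal k m (A ∪ W))) A.card := by
  classical
  induction W using Finset.induction_on with
  | empty =>
    rw [Finset.union_empty]
    exact not_hasProjectiveDimensionLT_of_private p hp hp'
  | insert w W hw ih =>
    intro hlt
    have hc := (h.colon hw).hasProjectiveDimensionLT (k := k)
    rw [h.sqfreeIdeal_colon,
      Finset.card_erase_add_one (h.right_mem w (Finset.mem_insert_self w W))] at hc
    rw [Finset.union_insert, sqfreeIdeal_insert] at hlt
    exact ih (h.mono (Finset.subset_insert w W))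
      ((sqfreeIdeal_colon_shortExact m (A ∪ W) w).hasProjectiveDimensionLT_X₂ _ hc hlt)

end IsPaired

end Bounds

/-! ### Combinatorics of proper `2`-stars -/

namespace DualHypergraph

variable {V : Type*} {H : DualHypergraph V}

/-- Every branch of a star contains a neighbour of the center. -/
theorem IsStar.exists_reachable_adj_center {U : Set V} {w : V} (h : H.IsStar U w)
    (x : ↥(U \ {w})) :
    ∃ y : ↥(U \ {w}), (H.graph.induce (U \ {w})).Reachable x y ∧ H.graph.Adj y w := by
  obtain ⟨q⟩ := h.connected.preconnected ⟨x, x.2.1⟩ ⟨w, h.center_mem⟩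
  suffices ∀ (s t : U) (_ : (H.graph.induce U).Walk s t) (hs : (s : V) ∈ U \ {w}), (t : V) = w →
      ∃ y : ↥(U \ {w}), (H.graph.induce (U \ {w})).Reachable ⟨s, hs⟩ y ∧ H.graph.Adj y w from
    this _ _ q x.2 rfl
  intro s t q
  induction q with
  | nil => exact fun hs ht => absurd ht hs.2
  | @cons s r t hsr q ih =>
    intro hs ht
    have hsr' : H.graph.Adj s r := hsr
    by_cases hr : (r : V) = w
    · exact ⟨⟨s, hs⟩, .refl _, hr ▸ hsr'⟩
    · obtain ⟨y, hy, hyw⟩ := ih ⟨r.2, hr⟩ ht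
      have hadj : (H.graph.induce (U \ {w})).Adj ⟨s, hs⟩ ⟨r, r.2, hr⟩ := hsr'
      exact ⟨y, hadj.reachable.trans hy, hyw⟩

theorem IsStar.not_triangle {U : Set V} {w : V} (h : H.IsStar U w) {x y z : V} (hx : x ∈ U)
    (hy : y ∈ U) (hz : z ∈ U) (hxy : H.graph.Adj x y) (hyz : H.graph.Adj y z) :
    ¬ H.graph.Adj x z := by
  classical
  intro hxz
  have hcl : (H.graph.induce U).IsNClique 3 {⟨x, hx⟩, ⟨y, hy⟩, ⟨z, hz⟩} :=
    SimpleGraph.is3Clique_triple_iff.2 ⟨hxy, hxz, hyz⟩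
  exact h.acyclic.cliqueFree le_rfl _ hcl

theorem IsOneDimensional.eq_or_eq (h : H.IsOneDimensional) {F : Finset V} (hF : F ∈ H.faces)
    {u v x : V} (hu : u ∈ F) (hv : v ∈ F) (huv : u ≠ v) (hx : x ∈ F) : x = u ∨ x = v := by
  classical
  by_contra hne
  push Not at hne
  have : ({u, v, x} : Finset V) ⊆ F := by
    simp [Finset.insert_subset_iff, hu, hv, hx]
  have := (Finset.card_le_card this).trans (h F hF)
  rw [Finset.card_eq_three.2 ⟨u, v, x, huv, hne.1.symm, hne.2.symm, rfl⟩] at this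
  lia

namespace IsUnionOfTreesAndCyclesOfProperStars

variable {d : ℕ} {c : V → V} (hc : H.IsUnionOfTreesAndCyclesOfProperStars d c)
include hc

theorem center_center {w : V} (hw : w ∈ Set.range c) : c w = w :=
  (hc.proper_star w hw).center_mem

theorem center_eq_of_adj {u v : V} (hv : v ∉ Set.range c) (h : H.graph.Adj v u) : c u = c v := by
  by_contra hne
  exact hv ⟨v, (hc.connected_via_centers v u h (Ne.symm hne)).1⟩

end IsUnionOfTreesAndCyclesOfProperStars

variable {c : V → V} (hc : H.IsUnionOfTreesAndCyclesOfProperStars 2 c) (hsep : H.IsSeparated)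
include hc hsep

/-- The far end of a branch of length two is closed: its only neighbour is the near end, from
which it has to be separated. -/
theorem isClosedVertex_of_not_adj_center [Finite V] {v : V} (hv : v ∉ Set.range c)
    (hadj : ¬ H.graph.Adj v (c v)) : H.IsClosedVertex v := by
  have hstar := hc.proper_star (c v) ⟨v, rfl⟩
  let v' : ↥({u | c u = c v} \ {c v}) := ⟨v, rfl, fun h => hv ⟨v, h.symm⟩⟩
  obtain ⟨a, hva, haw⟩ := hstar.exists_reachable_adj_center v'
  have hne : v' ≠ a := fun h => hadj (by rwa [← h] at haw)
  let B : H.Branch {u | c u = c v} (c v) := SimpleGraph.connectedComponentMk _ v'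
  have hB : B.supp = {v', a} := by
    refine (Set.eq_of_subset_of_ncard_le ?_ ?_).symm
    · rintro x (rfl | rfl)
      · rfl
      · exact SimpleGraph.ConnectedComponent.sound hva.symm
    · rw [Set.ncard_pair hne]
      exact hstar.branch_le B
  have hnbr : ∀ u, H.graph.Adj v u → u = a := fun u hu => by
    have hcu := hc.center_eq_of_adj hv hu
    have huw : u ≠ c v := fun h => hadj (h ▸ hu)
    have hmem : (⟨u, hcu, huw⟩ : ↥({u | c u = c v} \ {c v})) ∈ B.supp :=
      SimpleGraph.ConnectedComponent.sound
        (SimpleGraph.Adj.reachable (show (H.graph.induce _).Adj _ v' from hu.symm))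
    rw [hB] at hmem
    rcases hmem with h | h
    · exact absurd (congrArg Subtype.val h) hu.1.symm
    · exact congrArg Subtype.val h
  obtain ⟨F, hF, -, -, ⟨hvF, -⟩, -, haF⟩ := hsep v a fun h => hne (Subtype.ext h)
  have : F = {v} := by
    refine Finset.eq_singleton_iff_unique_mem.2 ⟨hvF, fun u hu => ?_⟩
    by_contra huv
    exact haF (hnbr u ⟨Ne.symm huv, F, hF, hvF, hu⟩ ▸ hu)
  rwa [this] at hF

/-- Every vertex which is not a center lies on a face containing no other such vertex. -/
theorem exists_private_face [Finite V] {v : V} (hv : v ∉ Set.range c) :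
    ∃ F ∈ H.faces, v ∈ F ∧ ∀ u ∈ F, u ∉ Set.range c → u = v := by
  by_cases hadj : H.graph.Adj v (c v)
  · obtain ⟨hne, F, hF, hvF, hwF⟩ := hadj
    refine ⟨F, hF, hvF, fun u hu huc => ?_⟩
    exact (hc.one_dimensional.eq_or_eq hF hvF hwF hne hu).resolve_right
      fun h => huc (h ▸ ⟨v, rfl⟩)
  · exact ⟨{v}, isClosedVertex_of_not_adj_center hc hsep hv hadj, by simp, by simp⟩

/-- The two vertices `a`, `b` of a branch of length two, where `a` is the one next to the
center `w`: as `b` is closed, `a` is open, so every face through `a` contains `w` or `b`. -/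
theorem exists_branch_pair [Finite V] {w : V} (hw : w ∈ Set.range c) :
    ∃ a b, a ≠ b ∧ a ∉ Set.range c ∧ b ∉ Set.range c ∧ c a = w ∧ c b = w ∧
      ∀ F ∈ H.faces, a ∈ F → w ∈ F ∨ b ∈ F := by
  have hstar := hc.proper_star w hw
  obtain ⟨B, hB⟩ := hstar.exists_branch
  have hnot (x : ↥({u | c u = w} \ {w})) : (x : V) ∉ Set.range c := fun hx =>
    x.2.2 ((hc.center_center hx).symm.trans x.2.1)
  obtain ⟨x, hx⟩ := B.nonempty_supp
  obtain ⟨a, hxa, haw⟩ := hstar.exists_reachable_adj_center x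
  have haB : a ∈ B.supp := (SimpleGraph.ConnectedComponent.sound hxa.symm).trans hx
  obtain ⟨b, hbB, hab⟩ : ∃ b ∈ B.supp, b ≠ a :=
    Set.exists_ne_of_one_lt_ncard (show 1 < B.supp.ncard by rw [← branchLength, hB]; lia) a
  have hBab : B.supp = {a, b} := by
    refine (Set.eq_of_subset_of_ncard_le ?_ ?_).symm
    · rintro y (rfl | rfl) <;> assumption
    · rw [Set.ncard_pair hab.symm]
      exact hB.le
  have hmemB (y : V) (hy : H.graph.Adj a y) : y = w ∨ y = b := by
    by_contra! hne
    have hcy : c y = w := (hc.center_eq_of_adj (hnot a) hy).trans a.2.1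
    have hadj : (H.graph.induce ({u | c u = w} \ {w})).Adj ⟨y, hcy, hne.1⟩ a := hy.symm
    have hmem : (⟨y, hcy, hne.1⟩ : ↥({u | c u = w} \ {w})) ∈ B.supp :=
      (SimpleGraph.ConnectedComponent.sound hadj.reachable).trans haB
    rw [hBab] at hmem
    rcases hmem with h | h
    · exact hy.1 (congrArg Subtype.val h).symm
    · exact hne.2 (congrArg Subtype.val h)
  have hadj : H.graph.Adj a b := by
    obtain ⟨q⟩ : (H.graph.induce _).Reachable a b :=
      SimpleGraph.ConnectedComponent.exact (haB.trans hbB.symm)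
    cases q with
    | nil => exact absurd rfl hab
    | @cons _ y _ hay _ =>
      have hay' : H.graph.Adj a y := hay
      exact (hmemB y hay').resolve_left y.2.2 ▸ hay'
  have hbw : ¬ H.graph.Adj b w :=
    hstar.not_triangle b.2.1 a.2.1 hstar.center_mem hadj.symm haw
  have hbcl : H.IsClosedVertex b :=
    isClosedVertex_of_not_adj_center hc hsep (hnot b) (by rwa [show c b = w from b.2.1])
  have hacl : ¬ H.IsClosedVertex a := fun h =>
    hstar.not_adj_closed a a.2.1 b b.2.1 hadj ⟨h, hbcl⟩
  refine ⟨a, b, fun h => hab (Subtype.ext h.symm), hnot a, hnot b, a.2.1, b.2.1,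
    fun F hF haF => ?_⟩
  obtain ⟨y, hyF, hya⟩ : ∃ y ∈ F, y ≠ (a : V) := by
    by_contra! h
    rw [Finset.eq_singleton_iff_unique_mem.2 ⟨haF, h⟩] at hF
    exact hacl hF
  rcases hmemB y ⟨hya.symm, F, hF, haF, hyF⟩ with rfl | rfl
  · exact Or.inl hyF
  · exact Or.inr hyF

end DualHypergraph

/-- The converse reading of `dualFaces`: every variable gives a face of the hypergraph. -/
theorem exists_dualFace {σ V : Type*} [Finite V] {H : DualHypergraph V} {m : V → Finset σ}
    (hH : H.faces = dualFaces m) (i : σ) : ∃ F ∈ H.faces, ∀ v, v ∈ F ↔ i ∈ m v := by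
  have := Set.toFinite {v | i ∈ m v}
  refine ⟨this.toFinset, ?_, fun v => by simp⟩
  rw [hH]
  exact ⟨i, fun v => by simp⟩

open DualHypergraph in
theorem proposition4p10 {k σ V : Type*} [Field k] [Finite σ] [Finite V]
    (H : DualHypergraph V) (hsep : H.IsSeparated)
    (c : V → V) (hc : H.IsUnionOfTreesAndCyclesOfProperStars 2 c)
    (I : Ideal (MvPolynomial σ k)) (m : V → Finset σ)
    (hm : IsMinimalSquarefreeGenerators I m) (hH : H.faces = dualFaces m) :
    projectiveDimension (ModuleCat.of (MvPolynomial σ k) (MvPolynomial σ k ⧸ I)) =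
      ((Nat.card V - (Set.range c).ncard : ℕ) : WithBot ℕ∞) := by
  classical
  have := Fintype.ofFinite V
  let W : Finset V := (Set.range c).toFinset
  have hW {v : V} : v ∈ W ↔ v ∈ Set.range c := Set.mem_toFinset
  have hA {v : V} : v ∈ Wᶜ ↔ v ∉ Set.range c := Finset.mem_compl.trans hW.not
  have hcard : Wᶜ.card = Nat.card V - (Set.range c).ncard := by
    rw [Finset.card_compl, Set.ncard_eq_toFinset_card', Nat.card_eq_fintype_card]
  have hI : sqfreeIdeal k m (Wᶜ ∪ W) = I := by
    rw [← hm.span_eq, Finset.union_comm, Finset.union_compl, sqfreeIdeal, Finset.coe_univ,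
      Set.image_univ]
    rfl
  have hpair : ∀ w, ∃ a b, w ∈ Set.range c → a ≠ b ∧ a ∉ Set.range c ∧ b ∉ Set.range c ∧
      c a = w ∧ c b = w ∧ ∀ F ∈ H.faces, a ∈ F → w ∈ F ∨ b ∈ F := fun w => by
    by_cases hw : w ∈ Set.range c
    · obtain ⟨a, b, h⟩ := exists_branch_pair hc hsep hw
      exact ⟨a, b, fun _ => h⟩
    · exact ⟨w, w, fun h => absurd h hw⟩
  choose a b hab using hpair
  -- A vertex other than the centers shares faces only with vertices of its own star.
  have hdisj {v w : V} (hv : v ∉ Set.range c) (hvw : c v ≠ w) (hw : w ∈ Set.range c) :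
      Disjoint (m v) (m w) := by
    refine Finset.disjoint_left.2 fun i hiv hiw => ?_
    obtain ⟨F, hF, hi⟩ := exists_dualFace hH i
    have hadj : H.graph.Adj v w :=
      ⟨fun h => hv (h ▸ hw), F, hF, (hi v).2 hiv, (hi w).2 hiw⟩
    exact hvw ((hc.center_eq_of_adj hv hadj).symm.trans (hc.center_center hw))
  have hP : IsPaired m Wᶜ W a b := by
    refine ⟨disjoint_compl_left, fun w hw => ?_, fun w hw => ?_, fun w hw => ?_,
      fun w hw i hi => ?_, fun w hw w' hw' hne h => ?_, fun w hw w' hw' hne h => ?_,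
      fun w hw w' hw' hne => ?_, fun w hw w' hw' hne => ?_⟩
    all_goals
      obtain ⟨hne₁, ha, hb, hca, hcb, hF⟩ := hab w (hW.1 hw)
    · exact hA.2 ha
    · exact hA.2 hb
    · exact hne₁
    · obtain ⟨F, hFH, hi'⟩ := exists_dualFace hH i
      exact (hF F hFH ((hi' _).2 hi)).imp (hi' _).1 (hi' _).1
    all_goals
      obtain ⟨-, ha', hb', hca', hcb', -⟩ := hab w' (hW.1 hw')
    · exact hne (hcb.symm.trans (h ▸ hca'))
    · exact hne (hcb.symm.trans (h ▸ hcb'))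
    · exact hdisj ha' (hca'.trans_ne hne.symm) (hW.1 hw)
    · exact hdisj hb' (hcb'.trans_ne hne.symm) (hW.1 hw)
  have hpriv : ∀ v, ∃ i, v ∈ Wᶜ → i ∈ m v ∧ ∀ u ∈ Wᶜ, v ≠ u → i ∉ m u := fun v => by
    by_cases hv : v ∈ Wᶜ
    · obtain ⟨F, hF, hvF, huniq⟩ := exists_private_face hc hsep (hA.1 hv)
      obtain ⟨i, hi⟩ : F ∈ dualFaces m := hH ▸ hF
      exact ⟨i, fun _ => ⟨(hi v).1 hvF,
        fun u hu hvu him => hvu (huniq u ((hi u).2 him) (hA.1 hu)).symm⟩⟩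
    · obtain ⟨F, hF, -⟩ := H.covers v
      obtain ⟨i, -⟩ : F ∈ dualFaces m := hH ▸ hF
      exact ⟨i, fun h => absurd h hv⟩
  choose p hp using hpriv
  rw [← hI, ← hcard]
  exact le_antisymm ((projectiveDimension_le_iff _ _).2 hP.hasProjectiveDimensionLT)
    ((projectiveDimension_ge_iff _ _).2
      (hP.not_hasProjectiveDimensionLT p (fun v hv => (hp v hv).1) fun v hv => (hp v hv).2))
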